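/- All rings are commutative with identity. An element $a$ of a ring $R$ is *adequate* if for every $b\in R$ there exist $r,s\in R$ such that $a=rs$, $rR+bR=R$, and $s'R+bR\neq R$ for each non-invertible divisor $s'$ of $s$. A ring $R$ is *$\pi$-adequate* if every finitely generated ideal of $R$ is principal and for every nonzero $a\in R$ there exists an integer $n\ge 1$ such that $a^n$ is adequate. A ring $R$ is an *elementary divisor ring* if for every (not necessarily square) matrix $A$ over $R$ there exist invertible matrices $P$ and $Q$ over $R$ such that $PAQ$ is a diagonal matrix $(d_{ij})$ in which $d_{ii}$ divides $d_{i+1,i+1}$ for each $i$. **Corollary 4.9.** Every $\pi$-adequate ring is an elementary divisor ring. -/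

import Mathlib

/-- An element `a` of a commutative ring is adequate: for every `b` there is a factorization
`a = r * s` with `rR + bR = R` such that `s'R + bR ≠ R` for every non-invertible divisor `s'`
of `s`. Here `IsCoprime x y` says that `u * x + v * y = 1` for some `u`, `v`, that is,
`xR + yR = R`. -/
def IsAdequateElement {R : Type*} [CommRing R] (a : R) : Prop :=
  ∀ b : R, ∃ r s : R, a = r * s ∧ IsCoprime r b ∧
    ∀ s' : R, s' ∣ s → ¬ IsUnit s' → ¬ IsCoprime s' b

/-- A `π`-adequate ring: a Bézout ring in which every nonzero element has a positive power
that is adequate. -/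
def IsPiAdequateRing (R : Type*) [CommRing R] : Prop :=
  IsBezout R ∧ ∀ a : R, a ≠ 0 → ∃ n : ℕ, 1 ≤ n ∧ IsAdequateElement (a ^ n)

/-- A (not necessarily square) matrix `D` is diagonal, and each diagonal entry divides the
next one. -/
def IsDivisibilityDiagonal {R : Type*} [CommRing R] {m n : ℕ}
    (D : Matrix (Fin m) (Fin n) R) : Prop :=
  (∀ (i : Fin m) (j : Fin n), (i : ℕ) ≠ (j : ℕ) → D i j = 0) ∧
  ∀ (k : ℕ) (hm : k + 1 < m) (hn : k + 1 < n),
    D ⟨k, Nat.lt_of_succ_lt hm⟩ ⟨k, Nat.lt_of_succ_lt hn⟩ ∣ D ⟨k + 1, hm⟩ ⟨k + 1, hn⟩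

/-- The matrix `A` admits diagonal reduction: `P * A * Q` is diagonal with each diagonal entry
dividing the next one, for some invertible square matrices `P` and `Q`. -/
def AdmitsDiagonalReduction {R : Type*} [CommRing R] {m n : ℕ}
    (A : Matrix (Fin m) (Fin n) R) : Prop :=
  ∃ (P : Matrix (Fin m) (Fin m) R) (Q : Matrix (Fin n) (Fin n) R),
    IsUnit P ∧ IsUnit Q ∧ IsDivisibilityDiagonal (P * A * Q)

/-- An elementary divisor ring: every matrix, of any size, admits diagonal reduction. -/
def IsElementaryDivisorRing (R : Type*) [CommRing R] : Prop :=
  ∀ (m n : ℕ) (A : Matrix (Fin m) (Fin n) R), AdmitsDiagonalReduction A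

/-! If `c ≠ 0` has an adequate power and `(a, b, c)` is unimodular, then some `b + t * a` is
coprime to `c`: write the power of `c` as `r * s` as in the definition of adequacy with respect to
`b`, and take `t = r`. So every proper quotient of a `π`-adequate ring has stable range one. For a
Bézout ring this yields both conditions of Kaplansky's criterion for elementary divisor rings.

For Kaplansky's criterion, a matrix is first multiplied by an invertible one such that every common
divisor of the entries of the first row divides all entries; two rows at a time, this reduces to
a `2 × 2` triangular matrix, where it is Kaplansky's condition. Reducing the first row to a single
entry `d` leaves a matrix all of whose entries are multiples of `d`, and induction applies. -/

section StableRange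

variable {R : Type*} [CommRing R]

/-- Almost stable range one: `R / cR` has stable range one for every `c ≠ 0`. -/
def HasAlmostStableRangeOne (R : Type*) [CommRing R] : Prop :=
  ∀ a b c : R, c ≠ 0 → Ideal.span {a, b, c} = ⊤ → ∃ t, IsCoprime (b + t * a) c

/-- A Hermite ring in Kaplansky's sense: every row `(a, b)` can be reduced to `(d, 0)` by
an invertible matrix on the right. Equivalently, `(a, b)` is a multiple of a unimodular row, which
is the form used here. -/
def IsHermiteRing (R : Type*) [CommRing R] : Prop :=
  ∀ a b : R, ∃ d a' b', a = d * a' ∧ b = d * b' ∧ IsCoprime a' b'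

/-- Kaplansky's condition on unimodular triples, which characterizes the elementary divisor rings
among the Hermite rings: the rows of the matrix with rows `(a, 0)` and `(b, c)` have a unimodular
linear combination. -/
def KaplanskyCondition (R : Type*) [CommRing R] : Prop :=
  ∀ a b c : R, Ideal.span {a, b, c} = ⊤ → ∃ p q, IsCoprime (p * a + q * b) (q * c)

theorem ideal_span_triple_eq_top_iff {a b c : R} :
    Ideal.span {a, b, c} = ⊤ ↔ ∃ x y z, x * a + y * b + z * c = 1 := by
  rw [Ideal.eq_top_iff_one, Ideal.span, Submodule.mem_span_triple]
  rfl

theorem IsAdequateElement.exists_isCoprime_add_mul [IsBezout R] {a b c : R}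
    (hc : IsAdequateElement c) (h : Ideal.span {a, b, c} = ⊤) :
    ∃ t, IsCoprime (b + t * a) c := by
  obtain ⟨r, s, rfl, hrb, hs⟩ := hc b
  refine ⟨r, .mul_right (hrb.symm.add_mul_left_left a) (IsRelPrime.isCoprime ?_)⟩
  rintro g ⟨k, hk⟩ hgs
  by_contra hg
  refine hs g hgs hg ?_
  obtain ⟨l, rfl⟩ := hgs
  obtain ⟨x, y, z, hxyz⟩ := ideal_span_triple_eq_top_iff.1 h
  obtain ⟨u, v, huv⟩ := hrb
  -- Modulo `g` and `b`, the product `r * a` vanishes and `r` is invertible.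
  have ha : a = u * k * g + (a * v - u) * b := by linear_combination u * hk - a * huv
  exact ⟨x * u * k + z * r * l, x * (a * v - u) + y, by linear_combination hxyz - x * ha⟩

theorem IsPiAdequateRing.hasAlmostStableRangeOne (hR : IsPiAdequateRing R) :
    HasAlmostStableRangeOne R := by
  intro a b c hc h
  have := hR.1
  obtain ⟨n, hn, hcn⟩ := hR.2 c hc
  have hpow : Ideal.span {a, b, c ^ n} = ⊤ := by
    rw [← Ideal.radical_eq_top, eq_top_iff, ← h, Ideal.span_le]
    rintro x (rfl | rfl | rfl)
    · exact Ideal.le_radical (Ideal.subset_span (by simp))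
    · exact Ideal.le_radical (Ideal.subset_span (by simp))
    · exact ⟨n, Ideal.subset_span (by simp)⟩
  obtain ⟨t, ht⟩ := hcn.exists_isCoprime_add_mul hpow
  exact ⟨t, (IsCoprime.pow_right_iff hn).1 ht⟩

theorem HasAlmostStableRangeOne.isHermiteRing [IsBezout R] (hR : HasAlmostStableRangeOne R) :
    IsHermiteRing R := by
  intro a b
  obtain ⟨a', ha⟩ := IsBezout.gcd_dvd_left a b
  obtain ⟨b', hb⟩ := IsBezout.gcd_dvd_right a b
  obtain ⟨x, y, hd⟩ := IsBezout.gcd_eq_sum a b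
  generalize IsBezout.gcd a b = d at *
  by_cases ha' : a' = 0
  · exact ⟨b, 0, 1, by simp [ha, ha'], by simp, isCoprime_one_right⟩
  -- As `R` may have zero divisors, `(a', b')` need not be unimodular, but its defect annihilates
  -- `d`, so that adding multiples of the defect to `b'` does not change `d * b'`.
  let c := 1 - (x * a' + y * b')
  have hdc : d * c = 0 := by linear_combination x * ha + y * hb - hd
  obtain ⟨t, ht⟩ := hR c b' a' ha'
    (ideal_span_triple_eq_top_iff.2 ⟨1, y, x, by simp only [c]; ring⟩)
  exact ⟨d, a', b' + t * c, ha, by linear_combination hb - t * hdc, ht.symm⟩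

theorem HasAlmostStableRangeOne.kaplanskyCondition (hR : HasAlmostStableRangeOne R) :
    KaplanskyCondition R := by
  intro a b c h
  by_cases hc : c = 0
  · obtain ⟨p, q, z, hpq⟩ := ideal_span_triple_eq_top_iff.1 h
    exact ⟨p, q, 1, 0, by simpa [hc] using hpq⟩
  · obtain ⟨t, ht⟩ := hR a b c hc h
    exact ⟨t, 1, by simpa [add_comm] using ht⟩

end StableRange

section CoordinateVectors

variable {R : Type*} [CommRing R] {ι κ : Type*}

theorem dvd_linearMap_apply (f : (ι → R) →ₗ[R] (κ → R)) {e : R} {x : ι → R}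
    (h : ∀ i, e ∣ x i) (k : κ) : e ∣ f x k := by
  choose y hy using h
  obtain rfl : x = e • y := funext hy
  simp

theorem forall_dvd_linearEquiv_apply_iff (f : (ι → R) ≃ₗ[R] (κ → R)) {e : R} {x : ι → R} :
    (∀ k, e ∣ f x k) ↔ ∀ i, e ∣ x i :=
  ⟨fun h i => by simpa using dvd_linearMap_apply f.symm.toLinearMap h i,
    dvd_linearMap_apply f.toLinearMap⟩

/-- The automorphism of `ι → R` given by a `2 × 2` matrix of determinant one acting on the
coordinates `i` and `j`. -/
def pairLinearEquiv [DecidableEq ι] {i j : ι} (hij : i ≠ j) (a b c d : R)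
    (h : a * d - b * c = 1) :
    (ι → R) ≃ₗ[R] (ι → R) where
  toFun y k := if k = i then a * y i + b * y j else if k = j then c * y i + d * y j else y k
  invFun y k := if k = i then d * y i - b * y j else if k = j then a * y j - c * y i else y k
  map_add' y z := by ext k; simp only [Pi.add_apply]; split_ifs <;> ring
  map_smul' r y := by
    ext k; simp only [Pi.smul_apply, smul_eq_mul, RingHom.id_apply]; split_ifs <;> ring
  left_inv y := by
    ext k
    simp only [hij.symm, if_true, if_false]
    split_ifs with hi hj
    · subst hi; linear_combination y k * h
    · subst hj; linear_combination y k * h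
    · rfl
  right_inv y := by
    ext k
    simp only [hij.symm, if_true, if_false]
    split_ifs with hi hj
    · subst hi; linear_combination y k * h
    · subst hj; linear_combination y k * h
    · rfl

namespace pairLinearEquiv

variable [DecidableEq ι] {i j : ι} (hij : i ≠ j) {a b c d : R} (h : a * d - b * c = 1) (y : ι → R)

theorem apply_left : pairLinearEquiv hij a b c d h y i = a * y i + b * y j :=
  if_pos rfl

theorem apply_right : pairLinearEquiv hij a b c d h y j = c * y i + d * y j :=
  (if_neg hij.symm).trans (if_pos rfl)

theorem apply_of_ne {k : ι} (hi : k ≠ i) (hj : k ≠ j) : pairLinearEquiv hij a b c d h y k = y k :=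
  (if_neg hi).trans (if_neg hj)

end pairLinearEquiv

theorem IsHermiteRing.exists_linearEquiv_apply_eq_zero (hR : IsHermiteRing R) [Finite ι]
    (i₀ : ι) (x : ι → R) : ∃ f : (ι → R) ≃ₗ[R] (ι → R), ∀ i, i ≠ i₀ → f x i = 0 := by
  classical
  have := Fintype.ofFinite ι
  suffices H : ∀ s : Finset ι, ∃ f : (ι → R) ≃ₗ[R] (ι → R), ∀ i ∈ s, i ≠ i₀ → f x i = 0 by
    obtain ⟨f, hf⟩ := H Finset.univ
    exact ⟨f, fun i => hf i (Finset.mem_univ i)⟩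
  intro s
  induction s using Finset.induction_on with
  | empty => exact ⟨.refl R _, by simp⟩
  | insert k s _ ih =>
    obtain ⟨f, hf⟩ := ih
    by_cases hk : i₀ = k
    · exact ⟨f, fun i hi hi₀ => hf i (Finset.mem_of_mem_insert_of_ne hi (hk ▸ hi₀)) hi₀⟩
    obtain ⟨d, a, b, ha, hb, u, v, huv⟩ := hR (f x i₀) (f x k)
    refine ⟨f.trans (pairLinearEquiv hk u v (-b) a (by linear_combination huv)),
      fun i hi hi₀ => ?_⟩
    rw [LinearEquiv.trans_apply]
    by_cases hik : i = k
    · rw [hik, pairLinearEquiv.apply_right, ha, hb]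
      ring
    · rw [pairLinearEquiv.apply_of_ne _ _ _ hi₀ hik,
        hf i (Finset.mem_of_mem_insert_of_ne hi hik) hi₀]

end CoordinateVectors

section Kaplansky

variable {R : Type*} [CommRing R]

theorem KaplanskyCondition.exists_combination (hK : KaplanskyCondition R) (hR : IsHermiteRing R)
    (a b c : R) :
    ∃ p q, IsCoprime p q ∧ ∀ e, e ∣ p * a + q * b → e ∣ q * c → e ∣ a ∧ e ∣ b ∧ e ∣ c := by
  obtain ⟨d, a, b, rfl, rfl, u, v, huv⟩ := hR a b
  obtain ⟨g, d, c, rfl, rfl, k, l, hkl⟩ := hR d c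
  obtain ⟨p, q, z, w, hzw⟩ := hK (d * a) (d * b) c
    (ideal_span_triple_eq_top_iff.2 ⟨k * u, k * v, l, by linear_combination hkl + k * d * huv⟩)
  refine ⟨p, q, ⟨z * (d * a), z * (d * b) + w * c, by linear_combination hzw⟩,
    fun e hab hc => ?_⟩
  have hg : e ∣ g := by
    have : g = z * (p * (g * d * a) + q * (g * d * b)) + w * (q * (g * c)) := by
      linear_combination -g * hzw
    rw [this]
    exact dvd_add (hab.mul_left z) (hc.mul_left w)
  exact ⟨(hg.mul_right d).mul_right a, (hg.mul_right d).mul_right b, hg.mul_right c⟩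

theorem KaplanskyCondition.exists_vector_combination (hK : KaplanskyCondition R)
    (hR : IsHermiteRing R) {κ : Type*} [Finite κ] (x y : κ → R) :
    ∃ p q : R, IsCoprime p q ∧
      ∀ e, (∀ j, e ∣ (p • x + q • y) j) → (∀ j, e ∣ x j) ∧ ∀ j, e ∣ y j := by
  classical
  rcases isEmpty_or_nonempty κ with _ | ⟨⟨j₀⟩⟩
  · exact ⟨1, 0, isCoprime_one_left, fun _ _ => ⟨isEmptyElim, isEmptyElim⟩⟩
  obtain ⟨f, hf⟩ := hR.exists_linearEquiv_apply_eq_zero j₀ x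
  -- In the new coordinates the rows are `(f x j₀, 0)` and `(f y j₀, z)`, and `z` enters only
  -- through the generator `g z j₀` of its content.
  let z := Function.update (f y) j₀ 0
  obtain ⟨g, hg⟩ := hR.exists_linearEquiv_apply_eq_zero j₀ z
  obtain ⟨p, q, hpq, hdvd⟩ := hK.exists_combination hR (f x j₀) (f y j₀) (g z j₀)
  refine ⟨p, q, hpq, fun e he => ?_⟩
  have hef : ∀ j, e ∣ p * f x j + q * f y j := by
    simpa using (forall_dvd_linearEquiv_apply_iff f).2 he
  have hqz : ∀ j, e ∣ (q • z) j := fun j => by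
    by_cases hj : j = j₀
    · simp [z, hj]
    · simpa [z, hj, hf j hj] using hef j
  have hqg : e ∣ q * g z j₀ := by simpa using (forall_dvd_linearEquiv_apply_iff g).2 hqz j₀
  obtain ⟨hx₀, hy₀, hz₀⟩ := hdvd e (hef j₀) hqg
  have hz : ∀ j, e ∣ z j := (forall_dvd_linearEquiv_apply_iff g).1 fun j => by
    by_cases hj : j = j₀
    · rwa [hj]
    · simp [hg j hj]
  constructor <;> refine (forall_dvd_linearEquiv_apply_iff f).1 fun j => ?_ <;>
    by_cases hj : j = j₀
  · rwa [hj]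
  · simp [hf j hj]
  · rwa [hj]
  · simpa [z, hj] using hz j

end Kaplansky

section MatrixEquivalence

open Matrix

variable {R : Type*} [CommRing R] {ι κ : Type*} [Fintype ι] [DecidableEq ι]
  [Fintype κ] [DecidableEq κ]

/-- Equivalence of matrices: `A` and `B` differ by invertible factors on both sides. -/
def MatrixEquivalent (A B : Matrix ι κ R) : Prop :=
  ∃ (P : Matrix ι ι R) (Q : Matrix κ κ R), IsUnit P ∧ IsUnit Q ∧ P * A * Q = B

namespace MatrixEquivalent

theorem refl (A : Matrix ι κ R) : MatrixEquivalent A A :=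
  ⟨1, 1, isUnit_one, isUnit_one, by simp⟩

theorem trans {A B C : Matrix ι κ R} (h : MatrixEquivalent A B) (h' : MatrixEquivalent B C) :
    MatrixEquivalent A C := by
  obtain ⟨P, Q, hP, hQ, rfl⟩ := h
  obtain ⟨P', Q', hP', hQ', rfl⟩ := h'
  exact ⟨P' * P, Q * Q', hP'.mul hP, hQ.mul hQ', by simp only [Matrix.mul_assoc]⟩

theorem transpose {A B : Matrix ι κ R} (h : MatrixEquivalent A B) : MatrixEquivalent Aᵀ Bᵀ := by
  obtain ⟨P, Q, hP, hQ, rfl⟩ := h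
  exact ⟨Qᵀ, Pᵀ, (isUnit_transpose Q).2 hQ, (isUnit_transpose P).2 hP,
    by simp [Matrix.mul_assoc]⟩

theorem map_cols (A : Matrix ι κ R) (f : (ι → R) ≃ₗ[R] (ι → R)) :
    MatrixEquivalent A (of fun i j => f (A.col j) i) := by
  refine ⟨LinearMap.toMatrix' f.toLinearMap, 1, ?_, isUnit_one, ?_⟩
  · exact LinearMap.isUnit_toMatrix'_iff.2 ((Module.End.isUnit_iff _).2 f.bijective)
  · rw [Matrix.mul_one]
    ext i j
    exact congr_fun (LinearMap.toMatrix'_mulVec f.toLinearMap (A.col j)) i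

theorem map_rows (A : Matrix ι κ R) (f : (κ → R) ≃ₗ[R] (κ → R)) :
    MatrixEquivalent A (of fun i => f (A.row i)) :=
  (map_cols Aᵀ f).transpose

theorem dvd {A B : Matrix ι κ R} (h : MatrixEquivalent A B) {e : R} (he : ∀ i j, e ∣ A i j)
    (i : ι) (j : κ) : e ∣ B i j := by
  obtain ⟨P, Q, -, -, rfl⟩ := h
  simp only [mul_apply]
  exact Finset.dvd_sum fun k _ => (Finset.dvd_sum fun l _ => (he l k).mul_left _).mul_right _

end MatrixEquivalent

theorem KaplanskyCondition.exists_matrixEquivalent_dvd_of_dvd_row (hK : KaplanskyCondition R)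
    (hR : IsHermiteRing R) (A : Matrix ι κ R) (i₀ : ι) :
    ∃ B, MatrixEquivalent A B ∧ ∀ e, (∀ j, e ∣ B i₀ j) → ∀ i j, e ∣ B i j := by
  suffices H : ∀ s : Finset ι,
      ∃ B, MatrixEquivalent A B ∧ ∀ e, (∀ j, e ∣ B i₀ j) → ∀ i ∈ s, ∀ j, e ∣ B i j by
    obtain ⟨B, hAB, hB⟩ := H Finset.univ
    exact ⟨B, hAB, fun e he i => hB e he i (Finset.mem_univ i)⟩
  intro s
  induction s using Finset.induction_on with
  | empty => exact ⟨A, .refl A, by simp⟩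
  | insert i₁ s _ ih =>
    obtain ⟨B, hAB, hB⟩ := ih
    by_cases hi₁ : i₀ = i₁
    · exact ⟨B, hAB, fun e he => Finset.forall_mem_insert .. |>.2 ⟨hi₁ ▸ he, hB e he⟩⟩
    obtain ⟨p, q, ⟨u, v, huv⟩, hdvd⟩ := hK.exists_vector_combination hR (B i₀) (B i₁)
    let f := pairLinearEquiv hi₁ p q (-v) u (by linear_combination huv)
    refine ⟨_, hAB.trans (.map_cols B f), fun e he i hi j => ?_⟩
    have hrow : ∀ j, f (B.col j) i₀ = (p • B i₀ + q • B i₁) j := fun j =>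
      pairLinearEquiv.apply_left hi₁ _ (B.col j)
    obtain ⟨he₀, he₁⟩ := hdvd e fun j => hrow j ▸ he j
    by_cases hii₀ : i = i₀
    · exact hii₀ ▸ he j
    simp only [of_apply, f]
    by_cases hii₁ : i = i₁
    · rw [hii₁, pairLinearEquiv.apply_right]
      exact dvd_add ((he₀ j).mul_left _) ((he₁ j).mul_left _)
    · rw [pairLinearEquiv.apply_of_ne _ _ _ hii₀ hii₁]
      exact hB e he₀ i (Finset.mem_of_mem_insert_of_ne hi hii₁) j

theorem KaplanskyCondition.exists_matrixEquivalent_pivot (hK : KaplanskyCondition R)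
    (hR : IsHermiteRing R) (A : Matrix ι κ R) (i₀ : ι) (j₀ : κ) :
    ∃ B, MatrixEquivalent A B ∧ (∀ i j, B i₀ j₀ ∣ B i j) ∧ ∀ j, j ≠ j₀ → B i₀ j = 0 := by
  obtain ⟨B, hAB, hB⟩ := hK.exists_matrixEquivalent_dvd_of_dvd_row hR A i₀
  obtain ⟨f, hf⟩ := hR.exists_linearEquiv_apply_eq_zero j₀ (B.row i₀)
  have hrow : ∀ j, f (B.row i₀) j₀ ∣ f (B.row i₀) j := fun j => by
    by_cases hj : j = j₀
    · rw [hj]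
    · simp [hf j hj]
  have hdvd : ∀ i j, f (B.row i₀) j₀ ∣ B i j :=
    hB _ ((forall_dvd_linearEquiv_apply_iff f).1 hrow)
  exact ⟨_, hAB.trans (.map_rows B f),
    fun i => (forall_dvd_linearEquiv_apply_iff f).2 (hdvd i), hf⟩

end MatrixEquivalence

section BorderedMatrix

open Matrix

variable {R : Type*} [CommRing R] {l m n : ℕ}

/-- The block diagonal matrix with blocks the scalar `a` and the matrix `A`, indexed by `Fin` so
that it can serve in an induction on the size. -/
def borderedMatrix (a : R) (A : Matrix (Fin m) (Fin n) R) :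
    Matrix (Fin (m + 1)) (Fin (n + 1)) R :=
  of (Fin.cons (Fin.cons a 0) fun i => Fin.cons 0 (A i))

namespace borderedMatrix

theorem mul (a b : R) (A : Matrix (Fin l) (Fin m) R) (B : Matrix (Fin m) (Fin n) R) :
    borderedMatrix a A * borderedMatrix b B = borderedMatrix (a * b) (A * B) := by
  ext i j
  cases i using Fin.cases <;> cases j using Fin.cases <;>
    simp [borderedMatrix, mul_apply, Fin.sum_univ_succ]

theorem one : borderedMatrix (1 : R) (1 : Matrix (Fin n) (Fin n) R) = 1 := by
  ext i j
  cases i using Fin.cases <;> cases j using Fin.cases <;>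
    simp [borderedMatrix, one_apply, Fin.ext_iff]

theorem isUnit {P : Matrix (Fin n) (Fin n) R} (hP : IsUnit P) : IsUnit (borderedMatrix 1 P) := by
  obtain ⟨Q, hQ⟩ := hP.exists_right_inv
  exact .of_mul_eq_one (borderedMatrix 1 Q) (by rw [mul, hQ, mul_one, one])

end borderedMatrix

theorem MatrixEquivalent.borderedMatrix {A B : Matrix (Fin m) (Fin n) R}
    (h : MatrixEquivalent A B) (d : R) :
    MatrixEquivalent (borderedMatrix d A) (borderedMatrix d B) := by
  obtain ⟨P, Q, hP, hQ, rfl⟩ := h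
  exact ⟨_, _, borderedMatrix.isUnit hP, borderedMatrix.isUnit hQ, by simp [borderedMatrix.mul]⟩

theorem IsDivisibilityDiagonal.borderedMatrix {D : Matrix (Fin m) (Fin n) R}
    (hD : IsDivisibilityDiagonal D) {d : R} (h : ∀ i j, d ∣ D i j) :
    IsDivisibilityDiagonal (borderedMatrix d D) := by
  refine ⟨fun i j hij => ?_, fun k hm hn => ?_⟩
  · cases i using Fin.cases with
    | zero => cases j using Fin.cases with
      | zero => exact absurd rfl hij
      | succ j => rfl
    | succ i => cases j using Fin.cases with
      | zero => rfl
      | succ j => exact hD.1 i j (by simpa using hij)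
  · cases k with
    | zero => exact h ⟨0, by omega⟩ ⟨0, by omega⟩
    | succ k => exact hD.2 k (by omega) (by omega)

theorem matrixEquivalent_borderedMatrix_of_pivot (A : Matrix (Fin (m + 1)) (Fin (n + 1)) R)
    (hdvd : ∀ i, A 0 0 ∣ A i 0) (hrow : ∀ j, j ≠ 0 → A 0 j = 0) :
    MatrixEquivalent A (borderedMatrix (A 0 0) (A.submatrix Fin.succ Fin.succ)) := by
  choose c hc using hdvd
  let v : Fin (m + 1) → R := Fin.cons 0 fun i => -c i.succ
  have hv : LinearMap.proj (R := R) (φ := fun _ => R) 0 v = 0 := rfl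
  convert MatrixEquivalent.map_cols A (LinearEquiv.transvection hv) using 1
  ext i j
  cases i using Fin.cases <;> cases j using Fin.cases <;>
    simp [borderedMatrix, v, LinearMap.transvection.apply, hrow, ← hc]

theorem KaplanskyCondition.exists_matrixEquivalent_borderedMatrix (hK : KaplanskyCondition R)
    (hR : IsHermiteRing R) (A : Matrix (Fin (m + 1)) (Fin (n + 1)) R) :
    ∃ d B, MatrixEquivalent A (borderedMatrix d B) ∧ ∀ i j, d ∣ B i j := by
  obtain ⟨B, hAB, hdvd, hrow⟩ := hK.exists_matrixEquivalent_pivot hR A 0 0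
  exact ⟨_, _, hAB.trans (matrixEquivalent_borderedMatrix_of_pivot B (hdvd · 0) hrow),
    fun i j => hdvd i.succ j.succ⟩

theorem KaplanskyCondition.exists_matrixEquivalent_isDivisibilityDiagonal
    (hK : KaplanskyCondition R) (hR : IsHermiteRing R) :
    ∀ {m n : ℕ} (A : Matrix (Fin m) (Fin n) R),
      ∃ D, MatrixEquivalent A D ∧ IsDivisibilityDiagonal D
  | 0, _, A => ⟨A, .refl A, fun i => i.elim0, fun _ hm => absurd hm (by omega)⟩
  | _ + 1, 0, A => ⟨A, .refl A, fun _ j => j.elim0, fun _ _ hn => absurd hn (by omega)⟩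
  | _ + 1, _ + 1, A => by
    obtain ⟨d, B, hAB, hdB⟩ := hK.exists_matrixEquivalent_borderedMatrix hR A
    obtain ⟨D, hBD, hD⟩ := hK.exists_matrixEquivalent_isDivisibilityDiagonal hR B
    exact ⟨_, hAB.trans (hBD.borderedMatrix d), hD.borderedMatrix (hBD.dvd hdB)⟩

end BorderedMatrix

theorem IsHermiteRing.isElementaryDivisorRing {R : Type*} [CommRing R] (hR : IsHermiteRing R)
    (hK : KaplanskyCondition R) : IsElementaryDivisorRing R := by
  intro m n A
  obtain ⟨_, ⟨P, Q, hP, hQ, rfl⟩, hD⟩ := hK.exists_matrixEquivalent_isDivisibilityDiagonal hR A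
  exact ⟨P, Q, hP, hQ, hD⟩

theorem corollary4p9_general (R : Type*) [CommRing R] [IsBezout R]
    (hR : HasAlmostStableRangeOne R) : IsElementaryDivisorRing R :=
  hR.isHermiteRing.isElementaryDivisorRing hR.kaplanskyCondition

theorem corollary4p9 (R : Type*) [CommRing R] (hR : IsPiAdequateRing R) :
    IsElementaryDivisorRing R := by
  have := hR.1
  exact corollary4p9_general R hR.hasAlmostStableRangeOne
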